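/- Let $SU(3)$ act on $\mathfrak{su}(3)$ by conjugation, let $\langle X,Y\rangle=\mathrm{tr}(X^\dagger Y)$, let $E_j=i\lambda_j/\sqrt2$ ($j=1,\dots,8$, $\lambda_j$ the Gell-Mann matrices) be the standard orthonormal basis of $\mathfrak{su}(3)$ with coordinates $x_1,\dots,x_8$ and structure constants $[E_k,E_j]=\sum_l c^l_{kj}E_l$, and let $\varpi_1=\tfrac1{\sqrt2}E_3+\tfrac1{\sqrt6}E_8$, $\varpi_2=\sqrt{2/3}\,E_8$. Dominant weights are $\omega_{(p,q)}=p\varpi_1+q\varpi_2$ with $p,q\in\mathbb N_0$. Let $\xi\in\mathfrak{su}(3)$ be a unit vector that is a positive multiple of a nonzero dominant weight, let $r(\xi)$ be the least $R>0$ such that $R\xi$ is a dominant weight, and write $r(\xi)\xi=\omega_{(p_1,q_1)}$. Let $\mathcal O_\xi$ be the orbit of $\xi$, with the invariant probability measure induced by Haar measure, the inner product $\langle f_1,f_2\rangle_\xi=\int_{\mathcal O_\xi}\overline{f_1}f_2$ and the supremum norm $\|\cdot\|_\xi$; let $Poly(\mathcal O_\xi)$ be the algebra of restrictions to $\mathcal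 O_\xi$ of complex polynomials on $\mathfrak{su}(3)$, with the Poisson bracket $\{\cdot,\cdot\}$ obtained by restricting $\{P,Q\}=\sum_{j,k,l}c^l_{kj}\,x_l\,\partial_jP\,\partial_kQ$. For $s\in\mathbb N=\{1,2,\dots\}$ let $\mathcal H_s$ be a unitary irreducible representation of $SU(3)$ with highest weight $s\,\omega_{(p_1,q_1)}$, and let $W^s:\mathcal B(\mathcal H_s)\to Poly(\mathcal O_\xi)$ be a symbol correspondence, that is, an injective linear $SU(3)$-equivariant map with $W^s_{A^\dagger}=\overline{W^s_A}$ and $\int_{\mathcal O_\xi}W^s_A=\mathrm{tr}(A)/\dim\mathcal H_s$. Let $\star^s$ be the product on the image of $W^s$ given by $W^s_A\star^sW^s_B=W^s_{AB}$. (Every $f\in Poly(\mathcal O_\xi)$ lies in the image of $W^s$ for all large $s$.) Assume that $(W^s)_{s}$ is of Poisson type: for all $f_1,f_2\in Poly(\mathcal O_\xi)$, $$\lim_{s\to\infty}\|f_1\star^sf_2-f_1f_2\|_\xi=0,\qquad \lim_{s\to\infty}\big\|s\,r(\xi)\,(f_1\star^sf_2-f_2\star^sf_1)-i\{f_1,f_2\}\big\|_\xi=0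 .$$ Let $\boldsymbol a=(a,b)\in\mathbb N_0^2$ and let $K$ be a unitary irreducible representation with highest weight $\omega_{(a,b)}$. For each $s$ let $e^s_1,\dots,e^s_{n_s}:K\to\mathcal B(\mathcal H_s)$ be isometric intertwiners (for the inner product $\mathrm{tr}(A^\dagger B)$) with pairwise orthogonal ranges whose sum is the $\boldsymbol a$-isotypic component of $\mathcal B(\mathcal H_s)$, and let $X_1,\dots,X_m:K\to Poly(\mathcal O_\xi)$ be isometric intertwiners (for $\langle\cdot,\cdot\rangle_\xi$) with pairwise orthogonal ranges whose sum is the $\boldsymbol a$-isotypic component of $Poly(\mathcal O_\xi)$. The characteristic matrix $\mathbf C^s_\xi(\boldsymbol a)$ of $W^s$ is the $m\times n_s$ matrix whose $(\gamma,\sigma)$ entry is $\big\langle X_\gamma(k),\,W^s(\sqrt{\dim\mathcal H_s}\;e^s_\sigma(k))\big\rangle_\xi$ for a unit vector $k\in K$ (it does not depend on $k$); equivalently, $W^s(\sqrt{\dim\mathcal H_s}\,e^s_\sigma(k))=\sum_\gamma \mathbf C^s_\xi(\boldsymbol a)_{\gamma\sigma}X_\gamma(k)$ for all $k\in K$. Then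 $n_s=m$ for all sufficiently large $s$, and $$\lim_{s\to\infty}\big(\mathbf C^s_\xi(\boldsymbol a)\big)^\dagger\,\mathbf C^s_\xi(\boldsymbol a)=\mathbf 1 .$$ -/

import Mathlib

open MeasureTheory Filter Topology
open scoped Matrix

namespace QuarkSystems

noncomputable section

/-! ### The group `SU(3)` and its normalized Haar measure -/

/-- The group `SU(3)`. -/
abbrev SU3 : Type := ↥(Matrix.specialUnitaryGroup (Fin 3) ℂ)

/-- Complex `3 × 3` matrices. -/
abbrev Mat3 : Type := Matrix (Fin 3) (Fin 3) ℂ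

instance instIsTopologicalGroupSU3 : IsTopologicalGroup SU3 where
  continuous_inv := by
    refine Continuous.subtype_mk ?_ _
    exact continuous_star.comp continuous_subtype_val

instance instCompactSpaceSU3 : CompactSpace SU3 := by
  have hc : IsCompact (Set.pi Set.univ fun _ : Fin 3 =>
      Set.pi Set.univ fun _ : Fin 3 => Metric.closedBall (0 : ℂ) 1) :=
    isCompact_univ_pi fun _ => isCompact_univ_pi fun _ => isCompact_closedBall 0 1
  have hcl : IsClosed {A : Mat3 | star A * A = 1 ∧ A * star A = 1 ∧ A.det = 1} := by
    refine IsClosed.and (isClosed_eq (by fun_prop) continuous_const)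
      (IsClosed.and (isClosed_eq (by fun_prop) continuous_const)
        (isClosed_eq (Continuous.matrix_det continuous_id) continuous_const))
  refine isCompact_iff_compactSpace.mp (IsCompact.of_isClosed_subset (t :=
    (Matrix.specialUnitaryGroup (Fin 3) ℂ : Set Mat3)) hc ?_ ?_)
  · convert hcl using 1
    ext A
    exact ⟨fun h => ⟨h.1.1, h.1.2, h.2⟩, fun h => ⟨⟨h.1, h.2.1⟩, h.2.2⟩⟩
  · intro A hA i _ j _
    simpa using entry_norm_bound_of_unitary (U := A) hA.1 i j

instance instMeasurableSpaceSU3 : MeasurableSpace SU3 := borel SU3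

instance instBorelSpaceSU3 : BorelSpace SU3 := ⟨rfl⟩

/-- The Haar measure of `SU(3)` of total mass one. -/
def haarSU3 : Measure SU3 := Measure.haarMeasure ⊤

/-! ### The Lie algebra `su(3)`, dominant weights and rational orbits -/

/-- The Gell-Mann matrices `λ₁, …, λ₈` (indexed from `0`). -/
def gellMann : Fin 8 → Mat3 :=
  ![!![0, 1, 0; 1, 0, 0; 0, 0, 0],
    !![0, -Complex.I, 0; Complex.I, 0, 0; 0, 0, 0],
    !![1, 0, 0; 0, -1, 0; 0, 0, 0],
    !![0, 0, 1; 0, 0, 0; 1, 0, 0],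
    !![0, 0, -Complex.I; 0, 0, 0; Complex.I, 0, 0],
    !![0, 0, 0; 0, 0, 1; 0, 1, 0],
    !![0, 0, 0; 0, 0, -Complex.I; 0, Complex.I, 0],
    ((√3 : ℝ) : ℂ)⁻¹ • !![1, 0, 0; 0, 1, 0; 0, 0, -2]]

/-- The basis `E_j = i λ_j / √2` of `su(3)`, orthonormal for `⟨X, Y⟩ = tr (X† Y)`. -/
def E (j : Fin 8) : Mat3 := (Complex.I / ((√2 : ℝ) : ℂ)) • gellMann j

/-- The coordinates `x_j = tr (E_j† X)` of a matrix in the basis `E_j`. -/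
def coord (X : Mat3) (j : Fin 8) : ℂ := ((E j)ᴴ * X).trace

/-- The first fundamental weight, as an element of `su(3)`. -/
def fundWeight₁ : Mat3 := ((1 / √2 : ℝ) : ℂ) • E 2 + ((1 / √6 : ℝ) : ℂ) • E 7

/-- The second fundamental weight, as an element of `su(3)`. -/
def fundWeight₂ : Mat3 := ((√(2 / 3) : ℝ) : ℂ) • E 7

/-- The dominant weight `ω_(p,q) = p ϖ₁ + q ϖ₂`. -/
def domWeight (p q : ℕ) : Mat3 := (p : ℂ) • fundWeight₁ + (q : ℂ) • fundWeight₂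

/-- The positive scalars that turn `ξ` into a dominant weight. -/
def integralScalars (ξ : Mat3) : Set ℝ :=
  {R | 0 < R ∧ ∃ p q : ℕ, (R : ℂ) • ξ = domWeight p q}

/-- The unit vectors of `su(3)` on the ray of a nonzero dominant weight. They
label the rational orbits. -/
def rationalPoints : Set Mat3 :=
  {ξ | (ξᴴ * ξ).trace = 1 ∧ (integralScalars ξ).Nonempty}

/-- The integral radius: the least `R > 0` such that `R ξ` is a dominant weight. -/
def intRadius (ξ : Mat3) : ℝ := sInf (integralScalars ξ)

/-- The adjoint orbit of `ξ`. -/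
def orbit (ξ : Mat3) : Set Mat3 :=
  Set.range fun g : SU3 => (g : Mat3) * ξ * (g : Mat3)ᴴ

/-- The base point moved by `g`, as a point of the orbit. -/
def orbitPoint (ξ : Mat3) (g : SU3) : orbit ξ := ⟨(g : Mat3) * ξ * (g : Mat3)ᴴ, g, rfl⟩

/-- The adjoint action of `SU(3)` on an orbit. -/
def ad (ξ : Mat3) (g : SU3) (x : orbit ξ) : orbit ξ :=
  ⟨(g : Mat3) * (x : Mat3) * (g : Mat3)ᴴ, by
    obtain ⟨_, h, rfl⟩ := x
    exact ⟨g * h, by simp [Matrix.mul_assoc, Matrix.conjTranspose_mul]⟩⟩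

/-! ### Polynomials on an orbit -/

/-- Restriction to the orbit of a complex polynomial in the coordinates `x₁, …, x₈` of `su(3)`. -/
def restrict (ξ : Mat3) : MvPolynomial (Fin 8) ℂ →ₐ[ℂ] (orbit ξ → ℂ) :=
  MvPolynomial.aeval fun j => fun x : orbit ξ => coord (x : Mat3) j

/-- The algebra of polynomial functions on the orbit. -/
def OrbitPoly (ξ : Mat3) : Subalgebra ℂ (orbit ξ → ℂ) := (restrict ξ).range

/-- Restriction of polynomials, as a map into `OrbitPoly ξ`. -/
def toPoly (ξ : Mat3) : MvPolynomial (Fin 8) ℂ →ₐ[ℂ] OrbitPoly ξ := (restrict ξ).rangeRestrict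

/-- The structure constants: `structConst l k j` is the coefficient of `E_l` in `[E_k, E_j]`. -/
def structConst (l k j : Fin 8) : ℂ := coord (E k * E j - E j * E k) l

/-- The Lie–Poisson (KAKS) bracket of polynomials on `su(3)`, given by the bivector
`∑ c^l_{kj} x_l ∂_j ⊗ ∂_k`. Its symplectic leaves are the orbits: the restriction of `{P, Q}` to
an orbit is the symplectic Poisson bracket of the restrictions of `P` and `Q`. -/
def lieBracket (P Q : MvPolynomial (Fin 8) ℂ) : MvPolynomial (Fin 8) ℂ :=
  ∑ j, ∑ k, ∑ l, MvPolynomial.C (structConst l k j) * MvPolynomial.X l *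
    MvPolynomial.pderiv j P * MvPolynomial.pderiv k Q

/-- The supremum norm on the orbit. -/
def supNorm {ξ : Mat3} (f : OrbitPoly ξ) : ℝ := ⨆ x : orbit ξ, ‖(f : orbit ξ → ℂ) x‖

/-- The normalized invariant integral on the orbit. -/
def orbitIntegral {ξ : Mat3} (f : orbit ξ → ℂ) : ℂ := ∫ g, f (orbitPoint ξ g) ∂haarSU3

/-- The inner product of functions on the orbit, conjugate-linear in the first argument. -/
def orbitInner {ξ : Mat3} (f₁ f₂ : OrbitPoly ξ) : ℂ :=
  orbitIntegral fun x : orbit ξ =>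
    (starRingEnd ℂ) ((f₁ : orbit ξ → ℂ) x) * (f₂ : orbit ξ → ℂ) x

/-! ### Quantum quark systems -/

section Representations

variable {H : Type*} [NormedAddCommGroup H] [InnerProductSpace ℂ H]

/-- `v` is a nonzero vector of weight `m ϖ₁ + n ϖ₂` for the diagonal torus of `SU(3)`. -/
def IsWeightVector (ρ : Representation ℂ SU3 H) (m n : ℤ) (v : H) : Prop :=
  v ≠ 0 ∧ ∀ g : SU3, (g : Mat3).IsDiag →
    ρ g v = ((g : Mat3) 0 0 ^ (m + n) * (g : Mat3) 1 1 ^ n) • v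

/-- `ρ` is a unitary irreducible representation of `SU(3)` with highest weight `ω_(p,q)`: this is
a weight of `ρ` and every weight of `ρ` is obtained from it by subtracting a sum of the simple
roots `2 ϖ₁ - ϖ₂` and `2 ϖ₂ - ϖ₁`. -/
structure IsQuarkSystem (p q : ℕ) (ρ : Representation ℂ SU3 H) : Prop where
  unitary : ∀ g v, ‖ρ g v‖ = ‖v‖
  continuous : ∀ v, Continuous fun g => ρ g v
  irreducible : ρ.IsIrreducible
  weight : ∃ v, IsWeightVector ρ p q v
  highest : ∀ m n : ℤ, (∃ v, IsWeightVector ρ m n v) →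
    ∃ k l : ℕ, m = p - 2 * k + l ∧ n = q + k - 2 * l

variable [FiniteDimensional ℂ H]

/-- The Hilbert–Schmidt inner product `tr (A† B)`. -/
def hsInner (A B : Module.End ℂ H) : ℂ := LinearMap.trace ℂ H (LinearMap.adjoint A * B)

/-- A symbol correspondence from the operators on `H` to the polynomials on the orbit: an
injective linear map that is equivariant, real and normalized. -/
structure IsSymbolCorrespondence {ξ : Mat3} (ρ : Representation ℂ SU3 H)
    (W : Module.End ℂ H →ₗ[ℂ] OrbitPoly ξ) : Prop where
  injective : Function.Injective W
  equivariant : ∀ (g : SU3) (A : Module.End ℂ H) (x : orbit ξ),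
    (W (ρ g * A * ρ g⁻¹) : orbit ξ → ℂ) (ad ξ g x) = (W A : orbit ξ → ℂ) x
  real : ∀ (A : Module.End ℂ H) (x : orbit ξ),
    (W (LinearMap.adjoint A) : orbit ξ → ℂ) x = (starRingEnd ℂ) ((W A : orbit ξ → ℂ) x)
  normalized : ∀ A : Module.End ℂ H,
    orbitIntegral (W A : orbit ξ → ℂ) = LinearMap.trace ℂ H A / (Module.finrank ℂ H : ℂ)

/-- The twisted product `W A ⋆ W B = W (A B)` on the image of `W` (with an unspecified value if
one of the factors is not in the image). -/
def twisted {ξ : Mat3} (W : Module.End ℂ H →ₗ[ℂ] OrbitPoly ξ) (f₁ f₂ : OrbitPoly ξ) : OrbitPoly ξ :=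
  W (Function.invFun W f₁ * Function.invFun W f₂)

end Representations

/-- A family of symbol correspondences is of Poisson type: `f₁ ⋆ˢ f₂ → f₁ f₂` and
`s r(ξ) [f₁, f₂]_⋆ˢ → i {f₁, f₂}` uniformly on the orbit, for all polynomials on the orbit. -/
structure IsPoissonType (ξ : Mat3) {H : ℕ → Type*} [∀ s, NormedAddCommGroup (H s)]
    [∀ s, InnerProductSpace ℂ (H s)] [∀ s, FiniteDimensional ℂ (H s)]
    (W : ∀ s, Module.End ℂ (H s) →ₗ[ℂ] OrbitPoly ξ) : Prop where
  product : ∀ f₁ f₂ : OrbitPoly ξ,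
    Tendsto (fun s => supNorm (twisted (W s) f₁ f₂ - f₁ * f₂)) atTop (𝓝 0)
  bracket : ∀ P₁ P₂ : MvPolynomial (Fin 8) ℂ,
    Tendsto (fun s : ℕ => supNorm
      (((s * intRadius ξ : ℝ) : ℂ) • (twisted (W s) (toPoly ξ P₁) (toPoly ξ P₂)
          - twisted (W s) (toPoly ξ P₂) (toPoly ξ P₁))
        - Complex.I • toPoly ξ (lieBracket P₁ P₂))) atTop (𝓝 0)

/-! ### Decompositions into irreducibles and characteristic matrices -/

section Decompositions

variable {K : Type*} [NormedAddCommGroup K] [InnerProductSpace ℂ K]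
  {H : Type*} [NormedAddCommGroup H] [InnerProductSpace ℂ H] {ξ : Mat3}

/-- `T` intertwines the representation `π` with the conjugation action on operators. -/
def IsOpIntertwiner (π : Representation ℂ SU3 K) (ρ : Representation ℂ SU3 H)
    (T : K →ₗ[ℂ] Module.End ℂ H) : Prop :=
  ∀ g k, T (π g k) = ρ g * T k * ρ g⁻¹

/-- `T` intertwines the representation `π` with the action on functions on the orbit. -/
def IsFunIntertwiner (π : Representation ℂ SU3 K) (T : K →ₗ[ℂ] OrbitPoly ξ) : Prop :=
  ∀ g k x, (T (π g k) : orbit ξ → ℂ) (ad ξ g x) = (T k : orbit ξ → ℂ) x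

/-- `e` is an orthogonal decomposition of the isotypic component of `π` in the space of operators
on `H` (with the Hilbert–Schmidt inner product) into copies of `π`: for an orthonormal basis
`k_ν` of `K`, the operators `e σ k_ν` form an orthonormal basis of this isotypic component, and
for each `σ` they transform as the `k_ν`. -/
structure IsOpDecomposition [FiniteDimensional ℂ H] (π : Representation ℂ SU3 K)
    (ρ : Representation ℂ SU3 H) {n : ℕ} (e : Fin n → K →ₗ[ℂ] Module.End ℂ H) : Prop where
  intertwines : ∀ σ, IsOpIntertwiner π ρ (e σ)
  orthonormal : ∀ σ τ k l, hsInner (e σ k) (e τ l) = if σ = τ then inner ℂ k l else 0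
  complete : ∀ T : K →ₗ[ℂ] Module.End ℂ H, IsOpIntertwiner π ρ T →
    T ∈ Submodule.span ℂ (Set.range e)

/-- `X` is an orthogonal decomposition of the isotypic component of `π` in the space of polynomial
functions on the orbit into copies of `π`; the functions `X γ k_ν` are the harmonic functions. -/
structure IsFunDecomposition (π : Representation ℂ SU3 K) {m : ℕ}
    (X : Fin m → K →ₗ[ℂ] OrbitPoly ξ) : Prop where
  intertwines : ∀ γ, IsFunIntertwiner π (X γ)
  orthonormal : ∀ γ δ k l, orbitInner (X γ k) (X δ l) = if γ = δ then inner ℂ k l else 0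
  complete : ∀ T : K →ₗ[ℂ] OrbitPoly ξ, IsFunIntertwiner π T → T ∈ Submodule.span ℂ (Set.range X)

/-- The characteristic matrix of `W` for the decompositions `e` and `X`, read off at a unit vector
`k` of the representation: its entries are the coefficients of the symbols of `√(dim H) (e σ k)`
in the orthonormal functions `X γ k`. -/
def charMatrix (W : Module.End ℂ H →ₗ[ℂ] OrbitPoly ξ) {n m : ℕ}
    (e : Fin n → K →ₗ[ℂ] Module.End ℂ H) (X : Fin m → K →ₗ[ℂ] OrbitPoly ξ) (k : K) :
    Matrix (Fin m) (Fin n) ℂ :=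
  Matrix.of fun γ σ =>
    orbitInner (X γ k) (W (((√(Module.finrank ℂ H : ℝ) : ℝ) : ℂ) • e σ k))

end Decompositions

end

end QuarkSystems

open QuarkSystems

/-
The function `f ⋆ˢ 1` is itself a symbol and tends to `f`, so the ranges of the `W s` are
asymptotically dense. Orthogonal projection onto the invariant range of `W s`, followed by the
inverse of `W s`, carries copies of `K` in `Poly(O_ξ)` to copies of `K` in `B(H_s)` and, by
density, keeps them independent for large `s`; hence `m ≤ n s`, while injectivity of `W s` gives
`n s ≤ m`. For large `s` the functions `X γ k` are therefore symbols of operators `A_γ`. The Gram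
matrix `G` of the `A_γ` for `tr(A†B) / dim H_s` and the characteristic matrix `C` satisfy
`Cᴴ G C = 1`, and by normalization `G γ δ` is the integral of the symbol of `A_γ† A_δ`, which
tends to `⟨X γ k, X δ k⟩ = δ_{γδ}` because the product of symbols is asymptotically pointwise. So
`G → 1`, and `Cᴴ C → 1`.
-/

namespace QuarkSystems

noncomputable section

section Haar

instance instIsHaarMeasureHaarSU3 : haarSU3.IsHaarMeasure := by
  unfold haarSU3
  infer_instance

instance instIsProbabilityMeasureHaarSU3 : IsProbabilityMeasure haarSU3 :=
  ⟨by simpa [haarSU3] using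
    Measure.haarMeasure_self (K₀ := (⊤ : TopologicalSpace.PositiveCompacts SU3))⟩

theorem integrable_haarSU3 {f : SU3 → ℂ} (hf : Continuous f) : Integrable f haarSU3 :=
  hf.integrable_of_hasCompactSupport (HasCompactSupport.of_compactSpace f)

end Haar

section Orbit

variable {ξ : Mat3}

theorem ad_orbitPoint (g h : SU3) : ad ξ g (orbitPoint ξ h) = orbitPoint ξ (g * h) :=
  Subtype.ext (by simp [ad, orbitPoint, Matrix.mul_assoc, Matrix.conjTranspose_mul])

theorem orbitPoint_surjective : Function.Surjective (orbitPoint ξ) := by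
  rintro ⟨_, g, rfl⟩
  exact ⟨g, rfl⟩

theorem continuous_orbitPoint : Continuous (orbitPoint ξ) := by
  refine Continuous.subtype_mk ?_ _
  exact (continuous_subtype_val.matrix_mul continuous_const).matrix_mul
    continuous_subtype_val.matrix_conjTranspose

theorem continuous_orbitPoly (f : OrbitPoly ξ) : Continuous (f : orbit ξ → ℂ) := by
  obtain ⟨_, P, rfl⟩ := f
  change Continuous (restrict ξ P)
  have hcoord : ∀ j, Continuous fun x : orbit ξ => coord (x : Mat3) j := fun j =>
    (continuous_const.matrix_mul continuous_subtype_val).matrix_trace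
  induction P using MvPolynomial.induction_on with
  | C a => simpa [restrict, Pi.algebraMap_def] using continuous_const
  | add p q hp hq => simpa using hp.add hq
  | mul_X p j hp => simpa [restrict] using hp.mul (hcoord j)

/-- Polynomial functions on the orbit, pulled back to the group along `g ↦ g ξ g†`. -/
def orbitPullback (ξ : Mat3) : OrbitPoly ξ →ₗ[ℂ] C(SU3, ℂ) where
  toFun f := ⟨fun g => (f : orbit ξ → ℂ) (orbitPoint ξ g),
    (continuous_orbitPoly f).comp continuous_orbitPoint⟩
  map_add' _ _ := rfl
  map_smul' _ _ := rfl

theorem orbitPullback_injective : Function.Injective (orbitPullback ξ) := fun _ _ h =>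
  Subtype.ext (orbitPoint_surjective.injective_comp_right (congrArg DFunLike.coe h))

theorem norm_orbitPullback_apply_le (f : OrbitPoly ξ) (g : SU3) :
    ‖orbitPullback ξ f g‖ ≤ supNorm f := by
  have : CompactSpace (orbit ξ) := orbitPoint_surjective.compactSpace continuous_orbitPoint
  exact le_ciSup (isCompact_range (continuous_orbitPoly f).norm).bddAbove (orbitPoint ξ g)

theorem norm_orbitIntegral_le (f : OrbitPoly ξ) :
    ‖orbitIntegral (f : orbit ξ → ℂ)‖ ≤ supNorm f :=
  (norm_integral_le_of_norm_le_const (ae_of_all _ (norm_orbitPullback_apply_le f))).trans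
    (by simp)

theorem orbitIntegral_sub (f f' : OrbitPoly ξ) :
    orbitIntegral ((f - f' : OrbitPoly ξ) : orbit ξ → ℂ) =
      orbitIntegral (f : orbit ξ → ℂ) - orbitIntegral (f' : orbit ξ → ℂ) :=
  integral_sub (integrable_haarSU3 (orbitPullback ξ f).continuous)
    (integrable_haarSU3 (orbitPullback ξ f').continuous)

theorem tendsto_orbitIntegral {ι : Type*} {l : Filter ι} {F : ι → OrbitPoly ξ} {f : OrbitPoly ξ}
    (h : Tendsto (fun a => supNorm (F a - f)) l (𝓝 0)) :
    Tendsto (fun a => orbitIntegral (F a : orbit ξ → ℂ)) l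
      (𝓝 (orbitIntegral (f : orbit ξ → ℂ))) := by
  rw [tendsto_iff_norm_sub_tendsto_zero]
  refine squeeze_zero (fun _ => norm_nonneg _) (fun a => ?_) h
  rw [← orbitIntegral_sub]
  exact norm_orbitIntegral_le _

theorem orbitInner_eq_of_ad {g : SU3} {f₁ f₂ f₁' f₂' : OrbitPoly ξ}
    (h₁ : ∀ x, (f₁' : orbit ξ → ℂ) (ad ξ g x) = (f₁ : orbit ξ → ℂ) x)
    (h₂ : ∀ x, (f₂' : orbit ξ → ℂ) (ad ξ g x) = (f₂ : orbit ξ → ℂ) x) :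
    orbitInner f₁' f₂' = orbitInner f₁ f₂ := by
  simp only [orbitInner, orbitIntegral, ← h₁, ← h₂, ad_orbitPoint]
  exact (integral_mul_left_eq_self _ g).symm

/-- Polynomial functions on the orbit as elements of `L²(SU(3))`. -/
def toL2 (ξ : Mat3) : OrbitPoly ξ →ₗ[ℂ] Lp ℂ 2 haarSU3 :=
  (ContinuousMap.toLp 2 haarSU3 ℂ).toLinearMap ∘ₗ orbitPullback ξ

theorem inner_toL2 (f₁ f₂ : OrbitPoly ξ) :
    inner ℂ (toL2 ξ f₁) (toL2 ξ f₂) = orbitInner f₁ f₂ :=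
  (ContinuousMap.inner_toLp haarSU3 (orbitPullback ξ f₁) (orbitPullback ξ f₂)).trans
    (integral_congr_ae (ae_of_all _ fun _ => mul_comm _ _))

theorem toL2_injective : Function.Injective (toL2 ξ) :=
  (ContinuousMap.toLp_injective haarSU3).comp orbitPullback_injective

theorem norm_toL2_le (f : OrbitPoly ξ) : ‖toL2 ξ f‖ ≤ supNorm f := by
  have hnonneg : 0 ≤ supNorm f := (norm_nonneg _).trans (norm_orbitPullback_apply_le f 1)
  have hbound : ∀ᵐ g ∂haarSU3, ‖toL2 ξ f g‖ ≤ supNorm f := by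
    filter_upwards [ContinuousMap.coeFn_toLp haarSU3 (p := 2) (𝕜 := ℂ) (orbitPullback ξ f)]
      with g hg
    exact (congrArg norm hg).trans_le (norm_orbitPullback_apply_le f g)
  simpa [measureUnivNNReal] using Lp.norm_le_of_ae_bound hnonneg hbound

end Orbit

section Approximation

variable {𝕜 E : Type*} [RCLike 𝕜] [NormedAddCommGroup E] [InnerProductSpace 𝕜 E]

theorem norm_starProjection_sub_le (U : Submodule 𝕜 E) [U.HasOrthogonalProjection] (x : E)
    {y : E} (hy : y ∈ U) : ‖U.starProjection x - x‖ ≤ ‖y - x‖ := by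
  rw [norm_sub_rev, norm_sub_rev y, U.starProjection_minimal]
  exact ciInf_le ⟨0, Set.forall_mem_range.2 fun _ => norm_nonneg _⟩ (⟨y, hy⟩ : U)

theorem eventually_linearIndependent_starProjection {ι α : Type*} [Finite ι] {l : Filter α}
    {x : ι → E} (hx : LinearIndependent 𝕜 x) (U : α → Submodule 𝕜 E)
    [∀ a, (U a).HasOrthogonalProjection] {y : α → ι → E} (hyU : ∀ a i, y a i ∈ U a)
    (hy : Tendsto y l (𝓝 x)) :
    ∀ᶠ a in l, LinearIndependent 𝕜 fun i => (U a).starProjection (x i) := by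
  suffices h : Tendsto (fun a i => (U a).starProjection (x i)) l (𝓝 x)
    from h.eventually hx.eventually
  refine tendsto_pi_nhds.2 fun i => tendsto_iff_norm_sub_tendsto_zero.2 ?_
  exact squeeze_zero (fun _ => norm_nonneg _)
    (fun a => norm_starProjection_sub_le (U a) (x i) (hyU a i))
    (tendsto_iff_norm_sub_tendsto_zero.1 (tendsto_pi_nhds.1 hy i))

end Approximation

section LinearAlgebra

theorem apply_mem_span_range {R ι M N : Type*} [CommSemiring R] [AddCommMonoid M] [AddCommMonoid N]
    [Module R M] [Module R N] {e : ι → M →ₗ[R] N} {T : M →ₗ[R] N}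
    (hT : T ∈ Submodule.span R (Set.range e)) (k : M) :
    T k ∈ Submodule.span R (Set.range fun i => e i k) := by
  have hmem := Submodule.apply_mem_span_image_of_mem_span (LinearMap.applyₗ k) hT
  rwa [← Set.range_comp] at hmem

variable {R V ι κ : Type*} [AddCommGroup V] [Fintype ι] [Fintype κ]

theorem card_le_card_of_linearIndependent_of_mem_span [Ring R] [StrongRankCondition R]
    [Module R V] {v : ι → V} {w : κ → V} (hv : LinearIndependent R v)
    (hvw : ∀ i, v i ∈ Submodule.span R (Set.range w)) : Fintype.card ι ≤ Fintype.card κ := by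
  classical
  exact (linearIndependent_le_span_aux' v hv _ (Set.range_subset_iff.2 hvw)).trans
    (Fintype.card_range_le w)

theorem span_eq_span_of_linearIndependent_of_card_eq [DivisionRing R] [Module R V]
    {v : ι → V} {w : κ → V} (hv : LinearIndependent R v)
    (hvw : ∀ i, v i ∈ Submodule.span R (Set.range w)) (hcard : Fintype.card ι = Fintype.card κ) :
    Submodule.span R (Set.range v) = Submodule.span R (Set.range w) := by
  have : FiniteDimensional R (Submodule.span R (Set.range w)) :=
    FiniteDimensional.span_of_finite R (Set.finite_range w)
  refine Submodule.eq_of_le_of_finrank_le (Submodule.span_le.2 (Set.range_subset_iff.2 hvw)) ?_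
  rw [finrank_span_eq_card hv, hcard]
  exact finrank_range_le_card w

end LinearAlgebra

section Symbols

variable {ξ : Mat3} {K : Type*} [NormedAddCommGroup K] [InnerProductSpace ℂ K]
  {π : Representation ℂ SU3 K} {H : Type*} [NormedAddCommGroup H] [InnerProductSpace ℂ H]
  [FiniteDimensional ℂ H] {ρ : Representation ℂ SU3 H} {W : Module.End ℂ H →ₗ[ℂ] OrbitPoly ξ}
  {n m : ℕ} {e : Fin n → K →ₗ[ℂ] Module.End ℂ H} {X : Fin m → K →ₗ[ℂ] OrbitPoly ξ} {k : K}

/-- The operator whose symbol is the orthogonal projection of `f` onto the space of symbols. -/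
def nearestOperator (hW : Function.Injective W) : OrbitPoly ξ →ₗ[ℂ] Module.End ℂ H :=
  (LinearEquiv.ofInjective (toL2 ξ ∘ₗ W) (toL2_injective.comp hW)).symm.toLinearMap ∘ₗ
    (LinearMap.range (toL2 ξ ∘ₗ W)).orthogonalProjectionOnto.toLinearMap ∘ₗ toL2 ξ

theorem toL2_nearestOperator (hW : Function.Injective W) (f : OrbitPoly ξ) :
    toL2 ξ (W (nearestOperator hW f)) =
      (LinearMap.range (toL2 ξ ∘ₗ W)).starProjection (toL2 ξ f) :=
  congrArg Subtype.val (LinearEquiv.apply_symm_apply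
    (LinearEquiv.ofInjective (toL2 ξ ∘ₗ W) (toL2_injective.comp hW)) _)

theorem orbitInner_nearestOperator (hW : Function.Injective W) (f : OrbitPoly ξ)
    (A : Module.End ℂ H) : orbitInner (W A) (W (nearestOperator hW f)) = orbitInner (W A) f := by
  have := (LinearMap.range (toL2 ξ ∘ₗ W)).starProjection_inner_eq_zero (toL2 ξ f) _ ⟨A, rfl⟩
  rw [inner_eq_zero_symm, ← toL2_nearestOperator hW, inner_sub_right, sub_eq_zero] at this
  simpa only [LinearMap.comp_apply, inner_toL2] using this.symm

theorem nearestOperator_eq (hW : Function.Injective W) {f : OrbitPoly ξ} {B : Module.End ℂ H}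
    (h : ∀ A, orbitInner (W A) (W B) = orbitInner (W A) f) : nearestOperator hW f = B := by
  refine (toL2_injective.comp hW) ((toL2_nearestOperator hW f).trans ?_)
  refine Submodule.eq_starProjection_of_mem_of_inner_eq_zero ⟨B, rfl⟩ ?_
  rintro _ ⟨A, rfl⟩
  rw [inner_eq_zero_symm, inner_sub_right, sub_eq_zero]
  simpa only [Function.comp_apply, LinearMap.comp_apply, inner_toL2] using (h A).symm

theorem IsSymbolCorrespondence.nearestOperator_conj (hW : IsSymbolCorrespondence ρ W) {g : SU3}
    {f f' : OrbitPoly ξ} (hf : ∀ x, (f' : orbit ξ → ℂ) (ad ξ g x) = (f : orbit ξ → ℂ) x) :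
    nearestOperator hW.injective f' = ρ g * nearestOperator hW.injective f * ρ g⁻¹ := by
  refine nearestOperator_eq hW.injective fun A => ?_
  have hA : A = ρ g * (ρ g⁻¹ * A * ρ g) * ρ g⁻¹ := by
    have hρ : ρ g * ρ g⁻¹ = 1 := by rw [← map_mul, mul_inv_cancel, map_one]
    rw [mul_assoc, mul_assoc, mul_assoc, hρ, mul_one, ← mul_assoc, hρ, one_mul]
  rw [hA, orbitInner_eq_of_ad (hW.equivariant g _) (hW.equivariant g _),
    orbitInner_eq_of_ad (hW.equivariant g _) hf, orbitInner_nearestOperator]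

theorem IsSymbolCorrespondence.isOpIntertwiner_nearestOperator (hW : IsSymbolCorrespondence ρ W)
    {T : K →ₗ[ℂ] OrbitPoly ξ} (hT : IsFunIntertwiner π T) :
    IsOpIntertwiner π ρ (nearestOperator hW.injective ∘ₗ T) := fun g k =>
  hW.nearestOperator_conj (hT g k)

theorem IsSymbolCorrespondence.isFunIntertwiner_comp (hW : IsSymbolCorrespondence ρ W)
    {T : K →ₗ[ℂ] Module.End ℂ H} (hT : IsOpIntertwiner π ρ T) :
    IsFunIntertwiner π (W ∘ₗ T) := fun g k x => by
  simpa only [LinearMap.comp_apply, hT g k] using hW.equivariant g (T k) x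

theorem IsOpDecomposition.linearIndependent (he : IsOpDecomposition π ρ e) (hk : ‖k‖ = 1) :
    LinearIndependent ℂ fun σ => e σ k :=
  .of_pairwise_dual_eq_zero_one _
    (fun σ => LinearMap.trace ℂ H ∘ₗ LinearMap.mulLeft ℂ (LinearMap.adjoint (e σ k)))
    (fun σ τ (hστ : σ ≠ τ) => (he.orthonormal σ τ k k).trans (if_neg hστ))
    fun σ => (he.orthonormal σ σ k k).trans (by simp [inner_self_eq_norm_sq_to_K, hk])

theorem IsFunDecomposition.orthonormal_toL2 (hX : IsFunDecomposition π X) (hk : ‖k‖ = 1) :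
    Orthonormal ℂ fun γ => toL2 ξ (X γ k) := by
  rw [orthonormal_iff_ite]
  intro γ δ
  simp [inner_toL2, hX.orthonormal, inner_self_eq_norm_sq_to_K, hk]

theorem IsFunDecomposition.sum_orbitInner_smul (hX : IsFunDecomposition π X) (hk : ‖k‖ = 1)
    {f : OrbitPoly ξ} (hf : f ∈ Submodule.span ℂ (Set.range fun γ => X γ k)) :
    ∑ γ, orbitInner (X γ k) f • X γ k = f := by
  obtain ⟨c, rfl⟩ := (Submodule.mem_span_range_iff_exists_fun ℂ).1 hf
  refine Finset.sum_congr rfl fun γ _ => ?_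
  rw [← inner_toL2, map_sum]
  simp only [map_smul, (hX.orthonormal_toL2 hk).inner_right_fintype]

theorem IsSymbolCorrespondence.symbol_mem_span (hW : IsSymbolCorrespondence ρ W)
    (he : IsOpDecomposition π ρ e) (hX : IsFunDecomposition π X) (k : K) (σ : Fin n) :
    W (e σ k) ∈ Submodule.span ℂ (Set.range fun γ => X γ k) :=
  apply_mem_span_range (hX.complete _ (hW.isFunIntertwiner_comp (he.intertwines σ))) k

theorem IsSymbolCorrespondence.linearIndependent_symbol (hW : IsSymbolCorrespondence ρ W)
    (he : IsOpDecomposition π ρ e) (hk : ‖k‖ = 1) : LinearIndependent ℂ fun σ => W (e σ k) :=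
  (he.linearIndependent hk).map_injOn W hW.injective.injOn

theorem IsSymbolCorrespondence.multiplicity_le (hW : IsSymbolCorrespondence ρ W)
    (he : IsOpDecomposition π ρ e) (hX : IsFunDecomposition π X) (hk : ‖k‖ = 1) : n ≤ m := by
  simpa using card_le_card_of_linearIndependent_of_mem_span (hW.linearIndependent_symbol he hk)
    (hW.symbol_mem_span he hX k)

theorem IsSymbolCorrespondence.le_multiplicity (hW : IsSymbolCorrespondence ρ W)
    (he : IsOpDecomposition π ρ e) (hX : IsFunDecomposition π X)
    (hind : LinearIndependent ℂ fun γ =>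
      (LinearMap.range (toL2 ξ ∘ₗ W)).starProjection (toL2 ξ (X γ k))) : m ≤ n := by
  simp only [← toL2_nearestOperator hW.injective] at hind
  have hmem : ∀ γ, nearestOperator hW.injective (X γ k) ∈
      Submodule.span ℂ (Set.range fun σ => e σ k) := fun γ =>
    apply_mem_span_range
      (he.complete _ (hW.isOpIntertwiner_nearestOperator (hX.intertwines γ))) k
  simpa using card_le_card_of_linearIndependent_of_mem_span
    (LinearIndependent.of_comp (toL2 ξ ∘ₗ W) hind) hmem

theorem IsSymbolCorrespondence.exists_symbol_eq (hW : IsSymbolCorrespondence ρ W)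
    (he : IsOpDecomposition π ρ e) (hX : IsFunDecomposition π X) (hk : ‖k‖ = 1) (hnm : n = m)
    (γ : Fin m) : ∃ A, W A = X γ k := by
  have hspan := span_eq_span_of_linearIndependent_of_card_eq (hW.linearIndependent_symbol he hk)
    (hW.symbol_mem_span he hX k) (by simpa using hnm)
  have hle : Submodule.span ℂ (Set.range fun σ => W (e σ k)) ≤ LinearMap.range W :=
    Submodule.span_le.2 (Set.range_subset_iff.2 fun σ => ⟨e σ k, rfl⟩)
  exact hle (hspan ▸ Submodule.subset_span ⟨γ, rfl⟩)

theorem IsSymbolCorrespondence.symbol_eq_sum_charMatrix (hW : IsSymbolCorrespondence ρ W)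
    (he : IsOpDecomposition π ρ e) (hX : IsFunDecomposition π X) (hk : ‖k‖ = 1) (σ : Fin n) :
    W (((√(Module.finrank ℂ H : ℝ) : ℝ) : ℂ) • e σ k) =
      ∑ γ, charMatrix W e X k γ σ • X γ k := by
  refine (hX.sum_orbitInner_smul hk ?_).symm
  rw [map_smul]
  exact Submodule.smul_mem _ _ (hW.symbol_mem_span he hX k σ)

theorem hsInner_smul_smul (c d : ℂ) (A B : Module.End ℂ H) :
    hsInner (c • A) (d • B) = starRingEnd ℂ c * hsInner A B * d := by
  simp only [hsInner, map_smulₛₗ, smul_mul_assoc, mul_smul_comm, smul_eq_mul, RingHom.id_apply]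
  ring

theorem hsInner_sum_sum {ι κ : Type*} (s : Finset ι) (t : Finset κ)
    (A : ι → Module.End ℂ H) (B : κ → Module.End ℂ H) :
    hsInner (∑ i ∈ s, A i) (∑ j ∈ t, B j) = ∑ i ∈ s, ∑ j ∈ t, hsInner (A i) (B j) := by
  simp only [hsInner, map_sum, Finset.sum_mul_sum]

/-- The Gram matrix of a family of operators, for the inner product `tr (A† B) / dim H`. -/
def gramMatrix {ι : Type*} (A : ι → Module.End ℂ H) : Matrix ι ι ℂ :=
  Matrix.of fun γ δ => hsInner (A γ) (A δ) / (Module.finrank ℂ H : ℂ)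

theorem conjTranspose_mul_gramMatrix_mul {ι κ : Type*} [Fintype ι] (C : Matrix ι κ ℂ)
    (A : ι → Module.End ℂ H) :
    Cᴴ * gramMatrix A * C = gramMatrix fun σ => ∑ γ, C γ σ • A γ := by
  ext σ τ
  simp only [gramMatrix, Matrix.mul_apply, Matrix.conjTranspose_apply, Matrix.of_apply,
    hsInner_sum_sum, hsInner_smul_smul, Finset.sum_mul, Finset.sum_div, ← starRingEnd_apply]
  rw [Finset.sum_comm]
  exact Finset.sum_congr rfl fun γ _ => Finset.sum_congr rfl fun δ _ => by ring

theorem IsOpDecomposition.finrank_ne_zero (he : IsOpDecomposition π ρ e) (hk : ‖k‖ = 1)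
    (σ : Fin n) : (Module.finrank ℂ H : ℂ) ≠ 0 := by
  intro h
  have := Module.finrank_zero_iff.1 (Nat.cast_eq_zero.1 h)
  exact (he.linearIndependent hk).ne_zero σ (Subsingleton.elim _ _)

theorem IsOpDecomposition.gramMatrix_eq_one (he : IsOpDecomposition π ρ e) (hk : ‖k‖ = 1) :
    gramMatrix (fun σ => ((√(Module.finrank ℂ H : ℝ) : ℝ) : ℂ) • e σ k) = 1 := by
  ext σ τ
  have hsqrt : ((√(Module.finrank ℂ H : ℝ) : ℝ) : ℂ) * ((√(Module.finrank ℂ H : ℝ) : ℝ) : ℂ) =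
      (Module.finrank ℂ H : ℂ) := by
    rw [← Complex.ofReal_mul, Real.mul_self_sqrt (Nat.cast_nonneg _), Complex.ofReal_natCast]
  rw [gramMatrix, Matrix.of_apply, hsInner_smul_smul, Complex.conj_ofReal, mul_right_comm, hsqrt,
    mul_div_cancel_left₀ _ (he.finrank_ne_zero hk σ), he.orthonormal, Matrix.one_apply,
    inner_self_eq_norm_sq_to_K, hk]
  simp only [map_one, one_pow]

theorem IsSymbolCorrespondence.conjTranspose_charMatrix_mul_gramMatrix_mul
    (hW : IsSymbolCorrespondence ρ W) (he : IsOpDecomposition π ρ e)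
    (hX : IsFunDecomposition π X) (hk : ‖k‖ = 1) {A : Fin m → Module.End ℂ H}
    (hA : ∀ γ, W (A γ) = X γ k) :
    (charMatrix W e X k)ᴴ * gramMatrix A * charMatrix W e X k = 1 := by
  rw [conjTranspose_mul_gramMatrix_mul, ← he.gramMatrix_eq_one hk]
  congr 1
  ext1 σ
  refine hW.injective ?_
  simp only [hW.symbol_eq_sum_charMatrix he hX hk, map_sum, map_smul W (charMatrix W e X k _ σ), hA]

end Symbols

section MatrixNorm

open scoped Matrix.Norms.L2Operator

variable {𝕜 m n : Type*} [RCLike 𝕜] [Fintype m] [Fintype n] [DecidableEq n]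

theorem norm_entry_le_l2_opNorm (A : Matrix m n 𝕜) (i : m) (j : n) : ‖A i j‖ ≤ ‖A‖ := by
  have hcol := Matrix.l2_opNorm_mulVec A (EuclideanSpace.single j 1)
  rw [PiLp.norm_single, norm_one, mul_one] at hcol
  refine le_trans (le_of_eq ?_) ((PiLp.norm_apply_le _ i).trans hcol)
  simp

theorem l2_opNorm_one_le : ‖(1 : Matrix n n 𝕜)‖ ≤ 1 := by
  rw [← Matrix.diagonal_one, Matrix.l2_opNorm_diagonal]
  exact (pi_norm_le_iff_of_nonneg zero_le_one).2 fun _ => by simp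

variable [DecidableEq m]

theorem norm_conjTranspose_mul_self_sub_one_le {C : Matrix m n 𝕜} {G : Matrix m m 𝕜}
    (h : Cᴴ * G * C = 1) (hG : ‖G - 1‖ < 1) :
    ‖Cᴴ * C - 1‖ ≤ ‖G - 1‖ / (1 - ‖G - 1‖) := by
  have heq : Cᴴ * C - 1 = -(Cᴴ * (G - 1) * C) := by
    rw [Matrix.mul_sub, Matrix.sub_mul, h, Matrix.mul_one, neg_sub]
  have hdefect : ‖Cᴴ * C - 1‖ ≤ ‖Cᴴ * C‖ * ‖G - 1‖ := by
    calc ‖Cᴴ * C - 1‖ = ‖Cᴴ * (G - 1) * C‖ := by rw [heq, norm_neg]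
      _ ≤ ‖Cᴴ‖ * ‖G - 1‖ * ‖C‖ :=
          (Matrix.l2_opNorm_mul _ _).trans (by gcongr; exact Matrix.l2_opNorm_mul _ _)
      _ = ‖Cᴴ * C‖ * ‖G - 1‖ := by
          rw [Matrix.l2_opNorm_conjTranspose_mul_self, Matrix.l2_opNorm_conjTranspose]
          ring
  have hnorm : ‖Cᴴ * C‖ ≤ ‖Cᴴ * C - 1‖ + 1 := by
    calc ‖Cᴴ * C‖ = ‖(Cᴴ * C - 1) + 1‖ := by rw [sub_add_cancel]
      _ ≤ ‖Cᴴ * C - 1‖ + 1 := (norm_add_le _ _).trans (by gcongr; exact l2_opNorm_one_le)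
  rw [le_div_iff₀ (sub_pos.2 hG)]
  nlinarith [mul_le_mul_of_nonneg_right hnorm (norm_nonneg (G - 1))]

theorem eventually_norm_conjTranspose_mul_self_sub_one_lt {α : Type*} {l : Filter α} {κ : α → Type*}
    [∀ a, Finite (κ a)] [∀ a, DecidableEq (κ a)] {C : ∀ a, Matrix m (κ a) 𝕜}
    {G : α → Matrix m m 𝕜} (h : ∀ᶠ a in l, (C a)ᴴ * G a * C a = 1) (hG : Tendsto G l (𝓝 1))
    {ε : ℝ} (hε : 0 < ε) : ∀ᶠ a in l, ∀ i j : κ a,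
      ‖((C a)ᴴ * C a - 1 : Matrix (κ a) (κ a) 𝕜) i j‖ < ε := by
  have hnorm : Tendsto (fun a => ‖G a - 1‖) l (𝓝 0) := tendsto_iff_norm_sub_tendsto_zero.1 hG
  have hbound : Tendsto (fun a => ‖G a - 1‖ / (1 - ‖G a - 1‖)) l (𝓝 0) := by
    have hdiv := Tendsto.div hnorm (tendsto_const_nhds.sub hnorm) (by simp : (1 : ℝ) - 0 ≠ 0)
    rwa [zero_div] at hdiv
  have := fun a => Fintype.ofFinite (κ a)
  filter_upwards [h, hnorm.eventually_lt_const one_pos, hbound.eventually_lt_const hε]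
    with a ha ha₁ haε i j
  exact (norm_entry_le_l2_opNorm _ i j).trans_lt
    ((norm_conjTranspose_mul_self_sub_one_le ha ha₁).trans_lt haε)

end MatrixNorm

section Limit

variable {ξ : Mat3} {H : ℕ → Type*} [∀ s, NormedAddCommGroup (H s)]
  [∀ s, InnerProductSpace ℂ (H s)] [∀ s, FiniteDimensional ℂ (H s)]
  {ρ : ∀ s, Representation ℂ SU3 (H s)} {W : ∀ s, Module.End ℂ (H s) →ₗ[ℂ] OrbitPoly ξ}

/-- The part of the Poisson condition that survives without the bracket: symbols are uniformly
dense in the limit `s → ∞`, and the product of operators converges to the product of functions.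
Here `f₁ ⋆ˢ f₂` is expressed by operators whose symbols are `f₁` and `f₂`, so that no convention
for functions outside the image of `W s` enters. -/
structure IsAsymptoticallyMultiplicative (W : ∀ s, Module.End ℂ (H s) →ₗ[ℂ] OrbitPoly ξ) :
    Prop where
  dense : ∀ f : OrbitPoly ξ, ∃ A : ∀ s, Module.End ℂ (H s),
    Tendsto (fun s => supNorm (W s (A s) - f)) atTop (𝓝 0)
  mul : ∀ (f₁ f₂ : OrbitPoly ξ) (A₁ A₂ : ∀ s, Module.End ℂ (H s)),
    (∀ᶠ s in atTop, W s (A₁ s) = f₁) → (∀ᶠ s in atTop, W s (A₂ s) = f₂) →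
      Tendsto (fun s => supNorm (W s (A₁ s * A₂ s) - f₁ * f₂)) atTop (𝓝 0)

theorem IsPoissonType.isAsymptoticallyMultiplicative (hP : IsPoissonType ξ W)
    (hW : ∀ᶠ s in atTop, Function.Injective (W s)) : IsAsymptoticallyMultiplicative W where
  -- Twisted products are symbols, so `f ⋆ˢ 1 → f` exhibits `f` as a limit of symbols.
  dense f := ⟨fun s => Function.invFun (W s) f * Function.invFun (W s) 1,
    by simpa only [twisted, mul_one] using hP.product f 1⟩
  mul f₁ f₂ A₁ A₂ h₁ h₂ := by
    refine (hP.product f₁ f₂).congr' ?_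
    filter_upwards [hW, h₁, h₂] with s hs hs₁ hs₂
    have hinv := Function.leftInverse_invFun hs
    rw [twisted, ← hs₁, ← hs₂, hinv, hinv]

theorem IsAsymptoticallyMultiplicative.eventually_linearIndependent_starProjection
    (hP : IsAsymptoticallyMultiplicative W) {ι : Type*} [Finite ι] {f : ι → OrbitPoly ξ}
    (hf : LinearIndependent ℂ fun i => toL2 ξ (f i)) :
    ∀ᶠ s in atTop, LinearIndependent ℂ fun i =>
      (LinearMap.range (toL2 ξ ∘ₗ W s)).starProjection (toL2 ξ (f i)) := by
  choose A hA using fun i => hP.dense (f i)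
  refine QuarkSystems.eventually_linearIndependent_starProjection hf _
    (y := fun s i => toL2 ξ (W s (A i s))) (fun s i => ⟨A i s, rfl⟩) ?_
  refine tendsto_pi_nhds.2 fun i => tendsto_iff_norm_sub_tendsto_zero.2 ?_
  refine squeeze_zero (fun _ => norm_nonneg _) (fun s => ?_) (hA i)
  rw [← map_sub]
  exact norm_toL2_le _

theorem IsAsymptoticallyMultiplicative.tendsto_hsInner (hP : IsAsymptoticallyMultiplicative W)
    (hW : ∀ᶠ s in atTop, IsSymbolCorrespondence (ρ s) (W s)) {f₁ f₂ : OrbitPoly ξ}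
    {A₁ A₂ : ∀ s, Module.End ℂ (H s)} (h₁ : ∀ᶠ s in atTop, W s (A₁ s) = f₁)
    (h₂ : ∀ᶠ s in atTop, W s (A₂ s) = f₂) :
    Tendsto (fun s => hsInner (A₁ s) (A₂ s) / (Module.finrank ℂ (H s) : ℂ)) atTop
      (𝓝 (orbitInner f₁ f₂)) := by
  obtain ⟨f₁', hf₁'⟩ : ∃ f₁' : OrbitPoly ξ, ∀ x,
      (f₁' : orbit ξ → ℂ) x = starRingEnd ℂ ((f₁ : orbit ξ → ℂ) x) := by
    obtain ⟨s, hs, rfl⟩ := (hW.and h₁).exists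
    exact ⟨_, hs.real (A₁ s)⟩
  have hadjoint : ∀ᶠ s in atTop, W s (LinearMap.adjoint (A₁ s)) = f₁' := by
    filter_upwards [hW, h₁] with s hs hs₁
    exact Subtype.ext (funext fun x => by rw [hs.real, hs₁, hf₁'])
  have hlim := tendsto_orbitIntegral (hP.mul f₁' f₂ _ A₂ hadjoint h₂)
  have hinner : orbitIntegral ((f₁' * f₂ : OrbitPoly ξ) : orbit ξ → ℂ) = orbitInner f₁ f₂ := by
    simp only [orbitInner, ← hf₁']
    rfl
  rw [hinner] at hlim
  refine hlim.congr' ?_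
  filter_upwards [hW] with s hs
  exact hs.normalized _

variable {K : Type*} [NormedAddCommGroup K] [InnerProductSpace ℂ K]
  {π : Representation ℂ SU3 K} {n : ℕ → ℕ} {e : ∀ s, Fin (n s) → K →ₗ[ℂ] Module.End ℂ (H s)}
  {m : ℕ} {X : Fin m → K →ₗ[ℂ] OrbitPoly ξ} {k : K}

theorem IsAsymptoticallyMultiplicative.tendsto_gramMatrix (hP : IsAsymptoticallyMultiplicative W)
    (hW : ∀ᶠ s in atTop, IsSymbolCorrespondence (ρ s) (W s)) (hX : IsFunDecomposition π X)
    (hk : ‖k‖ = 1) {A : ∀ s, Fin m → Module.End ℂ (H s)}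
    (hA : ∀ᶠ s in atTop, ∀ γ, W s (A s γ) = X γ k) :
    Tendsto (fun s => gramMatrix (A s)) atTop (𝓝 1) := by
  refine tendsto_pi_nhds.2 fun γ => tendsto_pi_nhds.2 fun δ => ?_
  have hlim := hP.tendsto_hsInner hW (hA.mono fun s hs => hs γ) (hA.mono fun s hs => hs δ)
  rwa [hX.orthonormal, inner_self_eq_norm_sq_to_K, hk, RCLike.ofReal_one, one_pow,
    ← Matrix.one_apply] at hlim

theorem IsAsymptoticallyMultiplicative.eventually_multiplicity_eq
    (hP : IsAsymptoticallyMultiplicative W)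
    (hW : ∀ᶠ s in atTop, IsSymbolCorrespondence (ρ s) (W s))
    (he : ∀ᶠ s in atTop, IsOpDecomposition π (ρ s) (e s)) (hX : IsFunDecomposition π X)
    (hk : ‖k‖ = 1) : ∀ᶠ s in atTop, n s = m := by
  filter_upwards [hW, he, hP.eventually_linearIndependent_starProjection
    (hX.orthonormal_toL2 hk).linearIndependent] with s hWs hes hind
  exact (hWs.multiplicity_le hes hX hk).antisymm (hWs.le_multiplicity hes hX hind)

end Limit

end

end QuarkSystems

theorem theorem3p15_general {ξ : Mat3} {H : ℕ → Type*} [∀ s, NormedAddCommGroup (H s)]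
    [∀ s, InnerProductSpace ℂ (H s)] [∀ s, FiniteDimensional ℂ (H s)]
    (ρ : ∀ s, Representation ℂ SU3 (H s)) (W : ∀ s, Module.End ℂ (H s) →ₗ[ℂ] OrbitPoly ξ)
    (hW : ∀ᶠ s in atTop, IsSymbolCorrespondence (ρ s) (W s))
    (hP : IsAsymptoticallyMultiplicative W)
    {K : Type*} [NormedAddCommGroup K] [InnerProductSpace ℂ K] (π : Representation ℂ SU3 K)
    (n : ℕ → ℕ) (e : ∀ s, Fin (n s) → K →ₗ[ℂ] Module.End ℂ (H s))
    (he : ∀ᶠ s in atTop, IsOpDecomposition π (ρ s) (e s))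
    (m : ℕ) (X : Fin m → K →ₗ[ℂ] OrbitPoly ξ) (hX : IsFunDecomposition π X)
    (k : K) (hk : ‖k‖ = 1) :
    (∀ᶠ s in atTop, n s = m) ∧
    ∀ ε > 0, ∀ᶠ s in atTop, ∀ i j : Fin (n s),
      ‖((charMatrix (W s) (e s) X k)ᴴ * charMatrix (W s) (e s) X k - 1 :
        Matrix (Fin (n s)) (Fin (n s)) ℂ) i j‖ < ε := by
  have hnm := hP.eventually_multiplicity_eq hW he hX hk
  refine ⟨hnm, fun ε hε => ?_⟩
  obtain ⟨A, hA⟩ : ∃ A : ∀ s, Fin m → Module.End ℂ (H s),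
      ∀ᶠ s in atTop, ∀ γ, W s (A s γ) = X γ k := by
    refine ⟨fun s γ => Function.invFun (W s) (X γ k), ?_⟩
    filter_upwards [hW, he, hnm] with s hWs hes hs γ
    exact Function.invFun_eq (hWs.exists_symbol_eq hes hX hk hs γ)
  have hgram : ∀ᶠ s in atTop, (charMatrix (W s) (e s) X k)ᴴ * gramMatrix (A s) *
      charMatrix (W s) (e s) X k = 1 := by
    filter_upwards [hW, he, hA] with s hWs hes hAs
    exact hWs.conjTranspose_charMatrix_mul_gramMatrix_mul hes hX hk hAs
  exact eventually_norm_conjTranspose_mul_self_sub_one_lt hgram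
    (hP.tendsto_gramMatrix hW hX hk hA) hε

theorem theorem3p15 {ξ : Mat3} (hξ : ξ ∈ rationalPoints)
    (p₁ q₁ : ℕ) (hω : domWeight p₁ q₁ = (intRadius ξ : ℂ) • ξ)
    {H : ℕ → Type*} [∀ s, NormedAddCommGroup (H s)] [∀ s, InnerProductSpace ℂ (H s)]
    [∀ s, FiniteDimensional ℂ (H s)]
    (ρ : ∀ s, Representation ℂ SU3 (H s))
    (hρ : ∀ s, 0 < s → IsQuarkSystem (s * p₁) (s * q₁) (ρ s))
    (W : ∀ s, Module.End ℂ (H s) →ₗ[ℂ] OrbitPoly ξ)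
    (hW : ∀ s, 0 < s → IsSymbolCorrespondence (ρ s) (W s))
    (hP : IsPoissonType ξ W)
    (a b : ℕ) {K : Type*} [NormedAddCommGroup K] [InnerProductSpace ℂ K]
    [FiniteDimensional ℂ K]
    (π : Representation ℂ SU3 K) (hπ : IsQuarkSystem a b π)
    (n : ℕ → ℕ) (e : ∀ s, Fin (n s) → K →ₗ[ℂ] Module.End ℂ (H s))
    (he : ∀ s, 0 < s → IsOpDecomposition π (ρ s) (e s))
    (m : ℕ) (X : Fin m → K →ₗ[ℂ] OrbitPoly ξ) (hX : IsFunDecomposition π X)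
    (k : K) (hk : ‖k‖ = 1) :
    (∀ᶠ s in atTop, n s = m) ∧
    ∀ ε > 0, ∀ᶠ s in atTop, ∀ i j : Fin (n s),
      ‖((charMatrix (W s) (e s) X k)ᴴ * charMatrix (W s) (e s) X k - 1 :
        Matrix (Fin (n s)) (Fin (n s)) ℂ) i j‖ < ε := by
  have hWev : ∀ᶠ s in atTop, IsSymbolCorrespondence (ρ s) (W s) := (eventually_gt_atTop 0).mono hW
  exact theorem3p15_general ρ W hWev
    (hP.isAsymptoticallyMultiplicative (hWev.mono fun _ h => h.injective)) π n e
    ((eventually_gt_atTop 0).mono he) m X hX k hk
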